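/- All operators are bounded linear operators on complex Hilbert spaces. An operator $T:H\to K$ is called norm attaining if there is a vector $x\in H$ with $\|x\|=1$ and $\|Tx\|=\|T\|$, and absolutely norm attaining ($\mathcal{AN}$) if for every non-zero closed subspace $M$ of $H$ the restriction $T|_M:M\to K$ is norm attaining. An operator $T$ on $H$ is idempotent if $T^2=T$. **Theorem.** (1) Let $H$ be a complex Hilbert space and let $T$ be an idempotent operator on $H$. If $T$ is $\mathcal{AN}$, then its Buckholtz operator $T+T^*-I$ is $\mathcal{AN}$. (2) The converse fails. Let $(e_k)_{k\ge 0}$ be the standard orthonormal basis of the space $\ell^2$ of square-summable complex sequences indexed by $k\ge 0$. There is an operator $T$ on $\ell^2$ with $$Te_{2m+1}=e_{2m+1}\ (m\ge 0),\qquad Te_{2m}=\tfrac{1}{m+1}\,e_{2m+1}\ (m\ge 0\text{ even}),\qquad Te_{2m}=0\ (m\ge 1\text{ odd}),$$ and this $T$ is idempotent, $T+T^*-I$ is $\mathcal{AN}$, but $T$ is not $\mathcal{AN}$. -/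

import Mathlib

/-- A bounded operator is norm attaining if its operator norm is attained at a unit vector. -/
def NormAttaining {E F : Type*} [NormedAddCommGroup E] [InnerProductSpace ℂ E]
    [NormedAddCommGroup F] [InnerProductSpace ℂ F] (T : E →L[ℂ] F) : Prop :=
  ∃ x : E, ‖x‖ = 1 ∧ ‖T x‖ = ‖T‖

/-- A bounded operator is absolutely norm attaining (AN) if its restriction to every non-zero
closed subspace of its domain is norm attaining. -/
def AbsolutelyNormAttaining {E F : Type*} [NormedAddCommGroup E] [InnerProductSpace ℂ E]
    [NormedAddCommGroup F] [InnerProductSpace ℂ F] (T : E →L[ℂ] F) : Prop :=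
  ∀ M : Submodule ℂ E, IsClosed (M : Set E) → M ≠ ⊥ → NormAttaining (T.comp M.subtypeL)

/-- The Buckholtz operator `T + T* - I`. -/
noncomputable def buckholtz {H : Type*} [NormedAddCommGroup H] [InnerProductSpace ℂ H]
    [CompleteSpace H] (T : H →L[ℂ] H) : H →L[ℂ] H :=
  T + ContinuousLinearMap.adjoint T - ContinuousLinearMap.id ℂ H

/-- The Hilbert space of square-summable complex sequences. -/
abbrev EllTwo : Type := lp (fun _ : ℕ => ℂ) 2

/-- The `k`-th standard basis vector of `ℓ²`, where indices start at `0`. -/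
noncomputable def ellTwoBasis (k : ℕ) : EllTwo := lp.single 2 k (1 : ℂ)

open Filter Topology
open scoped InnerProductSpace

/-! ### Norm attainment of compact operators -/

section Hilbert

variable {H : Type*} [NormedAddCommGroup H] [InnerProductSpace ℂ H]

/-! With `B = T + T* - I`, idempotency gives `B*B = I + (T - T*)*(T - T*)`. So on every closed
subspace, a unit vector maximizing the norm of `T - T*` also maximizes that of `B`, and `B` is AN as
soon as `T - T*` is compact. If an idempotent `T` has infinite-dimensional range and kernel, tilting
fixed vectors towards kernel vectors by angles tending to 0 yields a closed subspace where `T` has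
norm 1, unattained. Hence an AN idempotent has finite-dimensional range or kernel, and `T - T*` has
finite rank. The converse fails because `T - T*` can be compact while range and kernel are both
infinite-dimensional. -/

/-- A compact operator on a nontrivial Hilbert space attains its norm. -/
theorem IsCompactOperator.normAttaining {E F : Type*} [NormedAddCommGroup E]
    [InnerProductSpace ℂ E] [CompleteSpace E] [Nontrivial E] [NormedAddCommGroup F]
    [InnerProductSpace ℂ F] [CompleteSpace F] {C : E →L[ℂ] F} (hC : IsCompactOperator C) :
    NormAttaining C := by
  rcases eq_or_ne C 0 with rfl | hC0
  · obtain ⟨x, hx⟩ := exists_norm_eq E zero_le_one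
    exact ⟨x, hx, by simp⟩
  have hpos : 0 < ‖C‖ := norm_pos_iff.2 hC0
  have hseq : ∀ n : ℕ, ∃ x : E, ‖x‖ = 1 ∧ ‖C‖ - 1 / ((n : ℝ) + 1) ≤ ‖C x‖ := by
    intro n
    have hn : (0 : ℝ) < 1 / ((n : ℝ) + 1) := by positivity
    rcases le_or_gt (‖C‖ - 1 / ((n : ℝ) + 1)) 0 with h | h
    · obtain ⟨x, hx⟩ := exists_norm_eq E zero_le_one
      exact ⟨x, hx, h.trans (norm_nonneg _)⟩
    by_contra! hcon
    have : ‖C‖ ≤ ‖C‖ - 1 / ((n : ℝ) + 1) := by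
      refine C.opNorm_le_of_unit_norm h.le fun x hx => (hcon x hx).le
    linarith
  choose x hx1 hx2 using hseq
  have hlim : Tendsto (fun n => ‖C (x n)‖) atTop (𝓝 ‖C‖) := by
    refine tendsto_of_tendsto_of_tendsto_of_le_of_le (g := fun n : ℕ => ‖C‖ - 1 / ((n : ℝ) + 1))
      ?_ tendsto_const_nhds hx2 fun n => ?_
    · simpa using (tendsto_one_div_add_atTop_nhds_zero_nat (𝕜 := ℝ)).const_sub ‖C‖
    · simpa [hx1 n] using C.le_opNorm (x n)
  obtain ⟨K, hK, hKsub⟩ := (hC.clm_comp (ContinuousLinearMap.adjoint C)).image_closedBall_subset_compact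
    (f := ((ContinuousLinearMap.adjoint C ∘L C : E →L[ℂ] E) : E →ₗ[ℂ] E)) 1
  obtain ⟨y, -, φ, hφ, hy⟩ := hK.tendsto_subseq
    (x := fun n => ContinuousLinearMap.adjoint C (C (x n)))
    fun n => hKsub ⟨x n, by simp [hx1 n], rfl⟩
  set r : ℝ := ‖C‖ ^ 2 with hr
  have hrpos : 0 < r := by positivity
  -- A maximizing sequence consists of approximate eigenvectors of `C*C` for `r = ‖C‖²`: expand the
  -- square and use `‖C*C x‖ ≤ r`. Compactness of `C*C` then makes a subsequence of `x` itself
  -- converge.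
  have hbound : ∀ n, ‖ContinuousLinearMap.adjoint C (C (x n)) - (r : ℂ) • x n‖ ^ 2
      ≤ 2 * r * (r - ‖C (x n)‖ ^ 2) := by
    intro n
    have h1 : ‖ContinuousLinearMap.adjoint C (C (x n))‖ ≤ r := by
      refine (ContinuousLinearMap.le_opNorm _ _).trans ?_
      rw [LinearIsometryEquiv.norm_map, hr, sq]
      gcongr
      simpa [hx1 n] using C.le_opNorm (x n)
    rw [norm_sub_sq (𝕜 := ℂ), inner_smul_right, ContinuousLinearMap.adjoint_inner_left,
      inner_self_eq_norm_sq_to_K, norm_smul, hx1 n]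
    have h2 : RCLike.re ((r : ℂ) * ((‖C (x n)‖ : ℂ)) ^ 2) = r * ‖C (x n)‖ ^ 2 := by
      norm_cast
    have h3 : ‖(r : ℂ)‖ = r := by simp [abs_of_pos hrpos]
    erw [h2, h3]
    nlinarith [norm_nonneg (ContinuousLinearMap.adjoint C (C (x n)))]
  have hdiff : Tendsto (fun n => ContinuousLinearMap.adjoint C (C (x n)) - (r : ℂ) • x n) atTop
      (𝓝 0) := by
    rw [tendsto_zero_iff_norm_tendsto_zero]
    have : Tendsto (fun n => ‖ContinuousLinearMap.adjoint C (C (x n)) - (r : ℂ) • x n‖ ^ 2) atTop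
        (𝓝 0) := by
      refine squeeze_zero (fun n => by positivity) hbound ?_
      have := ((hlim.pow 2).const_sub r).const_mul (2 * r)
      simpa [hr] using this
    simpa using this.sqrt
  have hr0 : (r : ℂ) ≠ 0 := by exact_mod_cast hrpos.ne'
  have hxlim : Tendsto (x ∘ φ) atTop (𝓝 ((r : ℂ)⁻¹ • y)) := by
    have := (hy.sub (hdiff.comp hφ.tendsto_atTop)).const_smul (r : ℂ)⁻¹
    rw [sub_zero] at this
    refine this.congr fun n => ?_
    simp [smul_smul, hrpos.ne', -Complex.coe_smul, -smul_assoc]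
  refine ⟨(r : ℂ)⁻¹ • y, ?_, ?_⟩
  · refine tendsto_nhds_unique hxlim.norm ?_
    simp [hx1]
  · exact tendsto_nhds_unique ((C.continuous.tendsto _).comp hxlim).norm
      (hlim.comp hφ.tendsto_atTop)

theorem isCompactOperator_of_finiteDimensional_range {E F : Type*} [NormedAddCommGroup E]
    [NormedSpace ℂ E] [NormedAddCommGroup F] [NormedSpace ℂ F] (A : E →L[ℂ] F)
    [FiniteDimensional ℂ A.range] : IsCompactOperator A := by
  have : ProperSpace A.range := FiniteDimensional.proper ℂ A.range
  exact (isCompactOperator_of_locallyCompactSpace_dom A.rangeRestrict).clm_comp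
    A.range.subtypeL

/-! ### Compactness of `T - T*` and the Buckholtz operator -/

section Complete

variable [CompleteSpace H]

/-- `A*` kills the orthogonal complement of the range of `A`, so its range is the image of that
finite-dimensional space. -/
theorem finiteDimensional_range_adjoint (A : H →L[ℂ] H) [FiniteDimensional ℂ A.range] :
    FiniteDimensional ℂ (ContinuousLinearMap.adjoint A).range := by
  have hle : (ContinuousLinearMap.adjoint A).range ≤
      A.range.map (ContinuousLinearMap.adjoint A : H →ₗ[ℂ] H) := by
    rintro _ ⟨y, rfl⟩
    refine ⟨A.range.starProjection y, Submodule.starProjection_apply_mem _ _, ?_⟩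
    have h : y - A.range.starProjection y ∈ A.rangeᗮ :=
      Submodule.sub_starProjection_mem_orthogonal y
    rw [ContinuousLinearMap.orthogonal_range] at h
    have : ContinuousLinearMap.adjoint A (y - A.range.starProjection y) = 0 := h
    rw [map_sub, sub_eq_zero] at this
    exact this.symm
  exact Submodule.finiteDimensional_of_le hle

theorem isCompactOperator_sub_adjoint (A : H →L[ℂ] H) [FiniteDimensional ℂ A.range] :
    IsCompactOperator (A - ContinuousLinearMap.adjoint A : H →L[ℂ] H) := by
  have := finiteDimensional_range_adjoint A
  exact (isCompactOperator_of_finiteDimensional_range A).sub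
    (isCompactOperator_of_finiteDimensional_range (ContinuousLinearMap.adjoint A))

theorem norm_buckholtz_sq {T : H →L[ℂ] H} (hT : IsIdempotentElem T) (x : H) :
    ‖buckholtz T x‖ ^ 2 = ‖x‖ ^ 2 + ‖(T - ContinuousLinearMap.adjoint T) x‖ ^ 2 := by
  have h1 : ∀ y, T (T y) = T y := fun y => DFunLike.congr_fun hT y
  have key : ⟪buckholtz T x, buckholtz T x⟫_ℂ = ⟪x, x⟫_ℂ +
      ⟪(T - ContinuousLinearMap.adjoint T) x, (T - ContinuousLinearMap.adjoint T) x⟫_ℂ := by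
    have a1 : ⟪T x, ContinuousLinearMap.adjoint T x⟫_ℂ = ⟪T x, x⟫_ℂ := by
      rw [ContinuousLinearMap.adjoint_inner_right, h1]
    have a2 : ⟪ContinuousLinearMap.adjoint T x, T x⟫_ℂ = ⟪x, T x⟫_ℂ := by
      rw [ContinuousLinearMap.adjoint_inner_left, h1]
    have a3 : ⟪ContinuousLinearMap.adjoint T x, x⟫_ℂ = ⟪x, T x⟫_ℂ :=
      ContinuousLinearMap.adjoint_inner_left _ _ _
    have a4 : ⟪x, ContinuousLinearMap.adjoint T x⟫_ℂ = ⟪T x, x⟫_ℂ :=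
      ContinuousLinearMap.adjoint_inner_right _ _ _
    simp only [buckholtz, sub_apply, add_apply,
      ContinuousLinearMap.id_apply, inner_add_left, inner_add_right, inner_sub_left,
      inner_sub_right, a1, a2, a3, a4]
    ring
  simp only [inner_self_eq_norm_sq_to_K] at key
  exact_mod_cast key

/-- If `T - T*` is compact, the Buckholtz operator of the idempotent `T` is absolutely norm
attaining. -/
theorem absolutelyNormAttaining_buckholtz {T : H →L[ℂ] H} (hT : IsIdempotentElem T)
    (hC : IsCompactOperator (T - ContinuousLinearMap.adjoint T : H →L[ℂ] H)) :
    AbsolutelyNormAttaining (buckholtz T) := by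
  intro M hM hM0
  have : CompleteSpace M := hM.completeSpace_coe
  have : Nontrivial M := Submodule.nontrivial_iff_ne_bot.2 hM0
  have hCM : IsCompactOperator ((T - ContinuousLinearMap.adjoint T) ∘L M.subtypeL) :=
    hC.comp_clm M.subtypeL
  obtain ⟨x, hx, hmax⟩ := hCM.normAttaining
  have hB : ∀ y : M, ‖(buckholtz T ∘L M.subtypeL) y‖ ^ 2 =
      ‖y‖ ^ 2 + ‖((T - ContinuousLinearMap.adjoint T) ∘L M.subtypeL) y‖ ^ 2 := fun y =>
    norm_buckholtz_sq hT (y : H)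
  refine ⟨x, hx, le_antisymm ?_ ?_⟩
  · simpa [hx] using (buckholtz T ∘L M.subtypeL).le_opNorm x
  · refine ContinuousLinearMap.opNorm_le_of_unit_norm (norm_nonneg _) fun y hy => ?_
    refine (sq_le_sq₀ (norm_nonneg _) (norm_nonneg _)).1 ?_
    rw [hB, hB, hx, hy, hmax]
    gcongr
    simpa [hy] using
      ((T - ContinuousLinearMap.adjoint T) ∘L M.subtypeL).le_opNorm y

end Complete

/-! ### Idempotents with infinite-dimensional range and kernel -/

/-- Otherwise the orthogonal projection onto `F` would be injective on `R`. -/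
theorem exists_mem_orthogonal_norm_eq_one {R F : Submodule ℂ H} (hR : ¬ FiniteDimensional ℂ R)
    [FiniteDimensional ℂ F] : ∃ x ∈ R, x ∈ Fᗮ ∧ ‖x‖ = 1 := by
  by_contra! h
  apply hR
  refine FiniteDimensional.of_injective
    ((F.orthogonalProjectionOnto : H →ₗ[ℂ] F) ∘ₗ R.subtype) ?_
  rw [injective_iff_map_eq_zero]
  intro x hx
  have hxF : (x : H) ∈ Fᗮ := Submodule.orthogonalProjectionOnto_eq_zero_iff.1 hx
  by_contra hx0
  have hn : ‖(x : H)‖ ≠ 0 := by simpa using hx0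
  refine h (((‖(x : H)‖ : ℂ)⁻¹) • (x : H)) (R.smul_mem _ x.2) (Fᗮ.smul_mem _ hxF) ?_
  simp [norm_smul, hn]

/-- Two infinite-dimensional subspaces contain orthonormal sequences that are mutually
orthogonal. -/
theorem exists_orthonormal_sequences {R N : Submodule ℂ H} (hR : ¬ FiniteDimensional ℂ R)
    (hN : ¬ FiniteDimensional ℂ N) :
    ∃ u v : ℕ → H, (∀ n, u n ∈ R) ∧ (∀ n, v n ∈ N) ∧ Orthonormal ℂ u ∧ Orthonormal ℂ v ∧
      ∀ m n, ⟪u m, v n⟫_ℂ = 0 := by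
  classical
  obtain ⟨f, hf, hff⟩ := exists_seq_of_forall_finset_exists
    (fun p : H × H => p.1 ∈ R ∧ p.2 ∈ N ∧ ‖p.1‖ = 1 ∧ ‖p.2‖ = 1 ∧ ⟪p.1, p.2⟫_ℂ = 0)
    (fun p q : H × H => ⟪p.1, q.1⟫_ℂ = 0 ∧ ⟪p.1, q.2⟫_ℂ = 0 ∧ ⟪p.2, q.1⟫_ℂ = 0 ∧
      ⟪p.2, q.2⟫_ℂ = 0) (by
    intro s _
    set S : Finset H := s.image Prod.fst ∪ s.image Prod.snd with hS
    have hS1 : ∀ p ∈ s, p.1 ∈ S := fun p hp =>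
      Finset.mem_union_left _ (Finset.mem_image_of_mem _ hp)
    have hS2 : ∀ p ∈ s, p.2 ∈ S := fun p hp =>
      Finset.mem_union_right _ (Finset.mem_image_of_mem _ hp)
    have i1 : FiniteDimensional ℂ (Submodule.span ℂ (S : Set H)) :=
      FiniteDimensional.span_finset ℂ S
    obtain ⟨a, haR, haS, ha⟩ :=
      exists_mem_orthogonal_norm_eq_one (F := Submodule.span ℂ (S : Set H)) hR
    have i2 : FiniteDimensional ℂ (Submodule.span ℂ ((insert a S : Finset H) : Set H)) :=
      FiniteDimensional.span_finset ℂ _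
    obtain ⟨b, hbN, hbS, hb⟩ :=
      exists_mem_orthogonal_norm_eq_one
        (F := Submodule.span ℂ ((insert a S : Finset H) : Set H)) hN
    have ha' : ∀ y ∈ S, ⟪y, a⟫_ℂ = 0 := fun y hy => haS y (Submodule.subset_span hy)
    have hb' : ∀ y ∈ insert a S, ⟪y, b⟫_ℂ = 0 := fun y hy => hbS y (Submodule.subset_span hy)
    refine ⟨(a, b), ⟨haR, hbN, ha, hb, hb' a (Finset.mem_insert_self _ _)⟩, fun p hp => ?_⟩
    exact ⟨ha' _ (hS1 p hp), hb' _ (Finset.mem_insert_of_mem (hS1 p hp)), ha' _ (hS2 p hp),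
      hb' _ (Finset.mem_insert_of_mem (hS2 p hp))⟩)
  refine ⟨fun n => (f n).1, fun n => (f n).2, fun n => (hf n).1, fun n => (hf n).2.1,
    ⟨fun n => (hf n).2.2.1, fun m n hmn => ?_⟩, ⟨fun n => (hf n).2.2.2.1, fun m n hmn => ?_⟩,
    fun m n => ?_⟩
  · rcases hmn.lt_or_gt with h | h
    · exact (hff m n h).1
    · exact inner_eq_zero_symm.1 (hff n m h).1
  · rcases hmn.lt_or_gt with h | h
    · exact (hff m n h).2.2.2
    · exact inner_eq_zero_symm.1 (hff n m h).2.2.2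
  · rcases lt_trichotomy m n with h | rfl | h
    · exact (hff m n h).2.1
    · exact (hf m).2.2.2.2
    · exact inner_eq_zero_symm.1 (hff n m h).2.2.1

/-- An operator that fixes one orthonormal sequence and kills another one orthogonal to it is not
absolutely norm attaining. -/
theorem not_absolutelyNormAttaining_of_orthonormal {T : H →L[ℂ] H} {u v : ℕ → H}
    (hu : Orthonormal ℂ u) (hv : Orthonormal ℂ v) (huv : ∀ m n, ⟪u m, v n⟫_ℂ = 0)
    (hTu : ∀ n, T (u n) = u n) (hTv : ∀ n, T (v n) = 0) : ¬ AbsolutelyNormAttaining T := by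
  intro hAN
  have hvu : ∀ m n, ⟪v m, u n⟫_ℂ = 0 := fun m n => inner_eq_zero_symm.1 (huv n m)
  -- The angle `1/(n+1)` lies in `(0, 1]`, so the cosine is positive and tends to 1 while the sine
  -- never vanishes.
  set a : ℕ → ℝ := fun n => Real.cos (1 / ((n : ℝ) + 1)) with ha
  set b : ℕ → ℝ := fun n => Real.sin (1 / ((n : ℝ) + 1)) with hb
  have hab : ∀ n, a n ^ 2 + b n ^ 2 = 1 := fun n => Real.cos_sq_add_sin_sq _
  have hle1 : ∀ n : ℕ, 1 / ((n : ℝ) + 1) ≤ 1 := fun n => by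
    rw [div_le_one (by positivity)]
    linarith [n.cast_nonneg (α := ℝ)]
  have hb0 : ∀ n, b n ≠ 0 := fun n =>
    (Real.sin_pos_of_pos_of_le_one (by positivity) (hle1 n)).ne'
  have ha0 : ∀ n, 0 < a n := fun n => Real.cos_pos_of_le_one (by
    rw [abs_of_pos (by positivity)]
    exact hle1 n)
  have halim : Tendsto a atTop (𝓝 1) := by
    have := (Real.continuous_cos.tendsto 0).comp
      (tendsto_one_div_add_atTop_nhds_zero_nat (𝕜 := ℝ))
    simpa [ha, Function.comp_def] using this
  set w : ℕ → H := fun n => (a n : ℂ) • u n + (b n : ℂ) • v n with hw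
  have hTw : ∀ n, T (w n) = (a n : ℂ) • u n := fun n => by simp [hw, hTu, hTv]
  have hwnorm : ∀ n, ‖w n‖ = 1 := by
    intro n
    have h : ⟪(a n : ℂ) • u n, (b n : ℂ) • v n⟫_ℂ = 0 := by
      rw [inner_smul_left, inner_smul_right, huv]
      simp
    have := norm_add_sq_eq_norm_sq_add_norm_sq_of_inner_eq_zero _ _ h
    simp only [norm_smul, hu.1 n, hv.1 n, Complex.norm_real, Real.norm_eq_abs, mul_one,
      abs_mul_abs_self] at this
    have h2 : ‖w n‖ * ‖w n‖ = 1 := by rw [← hab n]; simpa [hw, sq] using this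
    nlinarith [norm_nonneg (w n)]
  set U : Submodule ℂ H := (Submodule.span ℂ (Set.range u)).topologicalClosure with hU
  have huU : ∀ n, u n ∈ U := fun n =>
    Submodule.le_topologicalClosure _ (Submodule.subset_span ⟨n, rfl⟩)
  have hUperp : ∀ x : H, (∀ n, ⟪u n, x⟫_ℂ = 0) → x ∈ Uᗮ := by
    intro x hx
    rw [hU, Submodule.orthogonal_closure]
    intro y hy
    refine Submodule.span_induction (p := fun y _ => ⟪y, x⟫_ℂ = 0) ?_ ?_ ?_ ?_ hy
    · rintro _ ⟨n, rfl⟩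
      exact hx n
    · simp
    · intro y z _ _ h1 h2
      rw [inner_add_left, h1, h2, add_zero]
    · intro c y _ h1
      rw [inner_smul_left, h1, mul_zero]
  have hvU : ∀ n, v n ∈ Uᗮ := fun n => hUperp _ fun m => huv m n
  -- On `M` the splitting `x = T x + (x - T x)` is orthogonal, so `T` is contractive there. The last
  -- condition makes the component of `x` in each plane spanned by `u n`, `v n` a multiple of `w n`.
  set M : Submodule ℂ H := U.comap (T : H →ₗ[ℂ] H) ⊓
    Uᗮ.comap ((ContinuousLinearMap.id ℂ H - T : H →L[ℂ] H) : H →ₗ[ℂ] H) ⊓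
    ⨅ n, (innerSL ℂ ((b n : ℂ) • u n - (a n : ℂ) • v n)).ker with hM
  have hmem : ∀ x, x ∈ M ↔ (T x ∈ U ∧ x - T x ∈ Uᗮ) ∧
      ∀ n, ⟪(b n : ℂ) • u n - (a n : ℂ) • v n, x⟫_ℂ = 0 := by
    intro x
    simp only [hM, Submodule.mem_inf, Submodule.mem_iInf]
    rfl
  have hMclosed : IsClosed (M : Set H) := by
    have h1 : IsClosed ((U.comap (T : H →ₗ[ℂ] H) : Submodule ℂ H) : Set H) :=
      (Submodule.isClosed_topologicalClosure _).preimage T.continuous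
    have h2 : IsClosed ((Uᗮ.comap ((ContinuousLinearMap.id ℂ H - T : H →L[ℂ] H) : H →ₗ[ℂ] H) :
        Submodule ℂ H) : Set H) :=
      (Submodule.isClosed_orthogonal _).preimage
        (ContinuousLinearMap.id ℂ H - T : H →L[ℂ] H).continuous
    have h3 : IsClosed ((⨅ n, (innerSL ℂ ((b n : ℂ) • u n - (a n : ℂ) • v n)).ker :
        Submodule ℂ H) : Set H) := by
      rw [Submodule.coe_iInf]
      exact isClosed_iInter fun n => ContinuousLinearMap.isClosed_ker _
    exact (h1.inter h2).inter h3
  have hwM : ∀ n, w n ∈ M := by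
    intro n
    rw [hmem, hTw]
    refine ⟨⟨U.smul_mem _ (huU n), ?_⟩, fun m => ?_⟩
    · rw [hw]
      simpa [-Complex.coe_smul] using Uᗮ.smul_mem (b n : ℂ) (hvU n)
    · simp only [hw, inner_sub_left, inner_add_right, inner_smul_left, inner_smul_right, huv, hvu,
        orthonormal_iff_ite.1 hu, orthonormal_iff_ite.1 hv, Complex.conj_ofReal]
      split_ifs with h
      · subst h
        ring
      · ring
  have hpyth : ∀ x ∈ M, ‖x‖ ^ 2 = ‖T x‖ ^ 2 + ‖x - T x‖ ^ 2 := by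
    intro x hx
    obtain ⟨⟨h1, h2⟩, -⟩ := (hmem x).1 hx
    have := norm_add_sq_eq_norm_sq_add_norm_sq_of_inner_eq_zero _ _ (h2 _ h1)
    rw [add_sub_cancel] at this
    simpa [sq] using this
  have hM0 : M ≠ ⊥ := by
    intro h
    have h0 : w 0 = 0 := by simpa [h] using hwM 0
    simpa [h0] using hwnorm 0
  obtain ⟨⟨x, hxM⟩, hx1, hx2⟩ := hAN M hMclosed hM0
  have hnorm : 1 ≤ ‖T ∘L M.subtypeL‖ := by
    refine le_of_tendsto' halim fun n => ?_
    have := (T ∘L M.subtypeL).le_opNorm ⟨w n, hwM n⟩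
    simpa [hTw, norm_smul, hu.1 n, hwnorm n, abs_of_pos (ha0 n)] using this
  have hx1' : ‖x‖ = 1 := hx1
  have hTx : 1 ≤ ‖T x‖ := hnorm.trans_eq hx2.symm
  -- Attaining norm at least 1 forces `x = T x ∈ U`, hence `x ⊥ v n`; the condition on each plane
  -- then gives `x ⊥ u n` for all `n`, so `x = 0`.
  have hfix : x - T x = 0 := by
    have := hpyth x hxM
    rw [hx1'] at this
    have h0 : ‖x - T x‖ ^ 2 ≤ 0 := by nlinarith
    have h1 : ‖x - T x‖ = 0 := by nlinarith [norm_nonneg (x - T x)]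
    exact norm_eq_zero.1 h1
  obtain ⟨⟨h1, -⟩, h3⟩ := (hmem x).1 hxM
  rw [← sub_eq_zero.1 hfix] at h1
  have hux : ∀ n, ⟪u n, x⟫_ℂ = 0 := by
    intro n
    have hvx : ⟪v n, x⟫_ℂ = 0 := inner_eq_zero_symm.1 (hvU n x h1)
    have := h3 n
    rw [inner_sub_left, inner_smul_left, inner_smul_left, hvx, mul_zero, sub_zero,
      Complex.conj_ofReal] at this
    exact (mul_eq_zero.1 this).resolve_left (by exact_mod_cast hb0 n)
  have : x = 0 := inner_self_eq_zero.1 (hUperp x hux x h1)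
  simp [this] at hx1'

/-- An absolutely norm attaining idempotent has finite-dimensional range or kernel. -/
theorem AbsolutelyNormAttaining.finiteDimensional_range_or {T : H →L[ℂ] H}
    (hT : IsIdempotentElem T) (hAN : AbsolutelyNormAttaining T) :
    FiniteDimensional ℂ T.range ∨ FiniteDimensional ℂ T.ker := by
  by_contra! h
  obtain ⟨u, v, hu, hv, hou, hov, huv⟩ := exists_orthonormal_sequences h.1 h.2
  refine not_absolutelyNormAttaining_of_orthonormal hou hov huv (fun n => ?_) (fun n => hv n) hAN
  obtain ⟨y, hy⟩ := hu n
  rw [← hy]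
  exact DFunLike.congr_fun hT y

theorem AbsolutelyNormAttaining.buckholtz [CompleteSpace H] {T : H →L[ℂ] H}
    (hT : IsIdempotentElem T) (hAN : AbsolutelyNormAttaining T) :
    AbsolutelyNormAttaining (buckholtz T) := by
  refine absolutelyNormAttaining_buckholtz hT ?_
  rcases hAN.finiteDimensional_range_or hT with h | h
  · exact isCompactOperator_sub_adjoint T
  · have hle : (1 - T : H →L[ℂ] H).range ≤ T.ker := by
      rintro _ ⟨y, rfl⟩
      have : T (T y) = T y := DFunLike.congr_fun hT y
      simp [this]
    have : FiniteDimensional ℂ (1 - T : H →L[ℂ] H).range := Submodule.finiteDimensional_of_le hle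
    -- Passing to the complementary idempotent only changes the sign of `T - T*`.
    have e : T - ContinuousLinearMap.adjoint T =
        -((1 - T) - ContinuousLinearMap.adjoint (1 - T)) := by
      rw [← ContinuousLinearMap.star_eq_adjoint, ← ContinuousLinearMap.star_eq_adjoint, star_sub,
        star_one]
      abel
    rw [e]
    exact (isCompactOperator_sub_adjoint (1 - T)).neg

end Hilbert

/-! ### The counterexample on `ℓ²` -/

section EllTwo

/-- Weighted composition operators on `ℓ²`. -/
theorem exists_weightedComp (σ : ℕ → ℕ) (hσ : Function.Injective σ) (c : ℕ → ℂ) {C : ℝ}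
    (hC : 0 ≤ C) (hc : ∀ n, ‖c n‖ ≤ C) :
    ∃ W : EllTwo →L[ℂ] EllTwo, ‖W‖ ≤ C ∧ ∀ x n, W x n = c n * x (σ n) := by
  have hp : (0 : ℝ) < (2 : ENNReal).toReal := by norm_num
  have hsum : ∀ (x : EllTwo) (s : Finset ℕ),
      ∑ n ∈ s, ‖c n * x (σ n)‖ ^ (2 : ENNReal).toReal ≤ (C * ‖x‖) ^ (2 : ENNReal).toReal := by
    intro x s
    calc ∑ n ∈ s, ‖c n * x (σ n)‖ ^ (2 : ENNReal).toReal
        ≤ ∑ n ∈ s, C ^ (2 : ENNReal).toReal * ‖x (σ n)‖ ^ (2 : ENNReal).toReal := by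
          refine Finset.sum_le_sum fun n _ => ?_
          rw [norm_mul, Real.mul_rpow (norm_nonneg _) (norm_nonneg _)]
          gcongr
          exact hc n
      _ = C ^ (2 : ENNReal).toReal * ∑ n ∈ s.map ⟨σ, hσ⟩, ‖x n‖ ^ (2 : ENNReal).toReal := by
          rw [Finset.sum_map, Finset.mul_sum]
          rfl
      _ ≤ C ^ (2 : ENNReal).toReal * ‖x‖ ^ (2 : ENNReal).toReal := by
          gcongr
          exact lp.sum_rpow_le_norm_rpow hp x _
      _ = _ := (Real.mul_rpow hC (norm_nonneg _)).symm
  let L : EllTwo →ₗ[ℂ] EllTwo :=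
    { toFun := fun x => ⟨fun n => c n * x (σ n), memℓp_gen' (hsum x)⟩
      map_add' := fun x y => by
        ext n
        exact mul_add _ _ _
      map_smul' := fun r x => by
        ext n
        exact mul_left_comm _ _ _ }
  refine ⟨L.mkContinuous C fun x => ?_, L.mkContinuous_norm_le hC _, fun x n => rfl⟩
  exact lp.norm_le_of_forall_sum_le hp (by positivity) (hsum x)

theorem finiteDimensional_range_of_forall_ge {A : EllTwo →L[ℂ] EllTwo} (N : ℕ)
    (hA : ∀ x, ∀ n, N ≤ n → A x n = 0) : FiniteDimensional ℂ A.range := by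
  refine FiniteDimensional.of_injective (V₂ := Fin N → ℂ)
    { toFun := fun y i => (y : EllTwo) i
      map_add' := fun y z => by ext i; simp
      map_smul' := fun r y => by ext i; simp } ?_
  rw [injective_iff_map_eq_zero]
  rintro ⟨_, ⟨x, rfl⟩⟩ hy
  refine Subtype.ext (lp.ext (funext fun n => ?_))
  rcases lt_or_ge n N with hn | hn
  · exact congrFun hy ⟨n, hn⟩
  · exact hA x n hn

theorem ellTwoBasis_apply (k n : ℕ) : ellTwoBasis k n = if n = k then 1 else 0 := by
  rw [ellTwoBasis, lp.single_apply, Pi.single_apply]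

theorem orthonormal_ellTwoBasis : Orthonormal ℂ ellTwoBasis := by
  rw [orthonormal_iff_ite]
  intro i j
  rw [ellTwoBasis, lp.inner_single_left]
  simp [ellTwoBasis_apply]

theorem exists_idempotent_buckholtz_not_absolutelyNormAttaining :
    ∃ T : EllTwo →L[ℂ] EllTwo,
        (∀ m : ℕ, T (ellTwoBasis (2 * m + 1)) = ellTwoBasis (2 * m + 1)) ∧
        (∀ m : ℕ, Even m →
          T (ellTwoBasis (2 * m)) = (1 / ((m : ℂ) + 1)) • ellTwoBasis (2 * m + 1)) ∧
        (∀ m : ℕ, Odd m → T (ellTwoBasis (2 * m)) = 0) ∧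
        IsIdempotentElem T ∧
        AbsolutelyNormAttaining (buckholtz T) ∧
        ¬ AbsolutelyNormAttaining T := by
  -- `T = D + K`: `D` projects onto the odd coordinates, and `K` sends `e_{2m}` to `e_{2m+1}/(m+1)`
  -- for even `m`. Thus `σ` swaps `2m` and `2m+1`, and `c` lives on `n = 2m+1` with `m` even, that
  -- is `n % 4 = 1`.
  set σ : ℕ → ℕ := fun n => if n % 2 = 0 then n + 1 else n - 1 with hσ
  have hσinj : Function.Injective σ := by
    intro m n h
    simp only [hσ] at h
    split_ifs at h <;> omega
  set c : ℕ → ℂ := fun n => if n % 4 = 1 then 1 / (((n / 2 : ℕ) : ℂ) + 1) else 0 with hc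
  have hcle : ∀ n, ‖c n‖ ≤ 2 * (1 / ((n : ℝ) + 1)) := by
    intro n
    simp only [hc]
    split_ifs with h
    · have e : ‖((n / 2 : ℕ) : ℂ) + 1‖ = ((n / 2 : ℕ) : ℝ) + 1 := by
        rw [← Nat.cast_succ, Complex.norm_natCast, Nat.cast_succ]
      rw [norm_div, norm_one, e, mul_one_div, div_le_div_iff₀ (by positivity) (by positivity)]
      have : n + 1 ≤ 2 * (n / 2 + 1) := by omega
      have : (n : ℝ) + 1 ≤ 2 * (((n / 2 : ℕ) : ℝ) + 1) := by exact_mod_cast this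
      linarith
    · rw [norm_zero]
      positivity
  have hpos : ∀ n : ℕ, (0 : ℝ) ≤ 2 * (1 / ((n : ℝ) + 1)) := fun n => by positivity
  have hmono : ∀ N n : ℕ, N ≤ n → 2 * (1 / ((n : ℝ) + 1)) ≤ 2 * (1 / ((N : ℝ) + 1)) := by
    intro N n h
    gcongr
  obtain ⟨D, -, hD⟩ := exists_weightedComp id Function.injective_id
    (fun n => if n % 2 = 1 then 1 else 0) zero_le_one (fun n => by split_ifs <;> simp)
  obtain ⟨K, -, hK⟩ := exists_weightedComp σ hσinj c (hpos 0)
    fun n => (hcle n).trans (hmono 0 n n.zero_le)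
  have hT : ∀ x n, (D + K) x n = (if n % 2 = 1 then 1 else 0) * x n + c n * x (σ n) := by
    intro x n
    rw [add_apply, lp.coeFn_add, Pi.add_apply, hD, hK, id]
  have hodd : ∀ m : ℕ, (D + K) (ellTwoBasis (2 * m + 1)) = ellTwoBasis (2 * m + 1) := by
    intro m
    ext n
    rw [hT]
    simp only [hc, hσ, ellTwoBasis_apply]
    split_ifs <;> first | omega | simp
  have hzero : ∀ m : ℕ, Odd m → (D + K) (ellTwoBasis (2 * m)) = 0 := by
    intro m hm
    rw [Nat.odd_iff] at hm
    ext n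
    rw [hT]
    simp only [hc, hσ, ellTwoBasis_apply]
    split_ifs <;> first | omega | simp
  -- `K` reads even coordinates and writes odd ones, so `DK = K`, `KD = 0` and `K² = 0`.
  have hidem : IsIdempotentElem (D + K) := by
    ext x n
    rw [mul_apply_eq_comp, hT, hT, hT]
    by_cases h : n % 2 = 1
    · have h1 : ¬ (σ n % 2 = 1) := by
        simp only [hσ]
        split_ifs <;> omega
      have h2 : c (σ n) = 0 := if_neg (by omega)
      simp [h, h1, h2]
    · have h2 : c n = 0 := if_neg (by omega)
      simp [h, h2]
  refine ⟨D + K, hodd, fun m hm => ?_, hzero, hidem, ?_, ?_⟩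
  · rw [Nat.even_iff] at hm
    ext n
    rw [hT, lp.coeFn_smul, Pi.smul_apply]
    by_cases hn : n = 2 * m + 1
    · have h1 : n % 4 = 1 := by omega
      have h2 : n / 2 = m := by omega
      have h3 : σ n = 2 * m := by simp only [hσ]; split_ifs <;> omega
      have h4 : n ≠ 2 * m := by omega
      simp only [hc, ellTwoBasis_apply, h1, h2, h3, if_neg h4, if_pos hn, if_true]
      simp
    · simp only [hc, hσ, ellTwoBasis_apply]
      split_ifs <;> first | omega | simp
  · refine absolutelyNormAttaining_buckholtz hidem ?_
    have hDadj : ContinuousLinearMap.adjoint D = D := by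
      symm
      rw [ContinuousLinearMap.eq_adjoint_iff]
      intro x y
      rw [lp.inner_eq_tsum, lp.inner_eq_tsum]
      refine tsum_congr fun n => ?_
      rw [hD, hD]
      split_ifs <;> simp
    -- `R N` is the tail of `K` from coordinate `N` on; its norm tends to 0 and `K - R N` has finite
    -- rank. As `D` is self-adjoint, `T - T* = K - K*` is a norm limit of finite-rank operators.
    have htail : ∀ N : ℕ, ∃ R : EllTwo →L[ℂ] EllTwo, ‖R‖ ≤ 2 * (1 / ((N : ℝ) + 1)) ∧
        ∀ x n, R x n = (if n < N then 0 else c n) * x (σ n) := fun N =>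
      exists_weightedComp σ hσinj _ (hpos N) fun n => by
        split_ifs with h
        · simpa using hpos N
        · exact (hcle n).trans (hmono N n (not_lt.1 h))
    choose R hR1 hR2 using htail
    have hRlim : Tendsto (fun N => K - R N) atTop (𝓝 K) := by
      have h0 : Tendsto R atTop (𝓝 0) := by
        refine squeeze_zero_norm hR1 ?_
        simpa using (tendsto_one_div_add_atTop_nhds_zero_nat (𝕜 := ℝ)).const_mul 2
      simpa using tendsto_const_nhds.sub h0
    have hlim : Tendsto (fun N => (K - R N) - ContinuousLinearMap.adjoint (K - R N)) atTop
        (𝓝 (D + K - ContinuousLinearMap.adjoint (D + K))) := by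
      have e : D + K - ContinuousLinearMap.adjoint (D + K) = K - ContinuousLinearMap.adjoint K := by
        rw [map_add, hDadj, add_sub_add_left_eq_sub]
      rw [e]
      exact hRlim.sub
        ((ContinuousLinearMap.adjoint (𝕜 := ℂ) (E := EllTwo) (F := EllTwo)).continuous.tendsto K
          |>.comp hRlim)
    refine isCompactOperator_of_tendsto hlim (Eventually.of_forall fun N => ?_)
    have : FiniteDimensional ℂ (K - R N).range := by
      refine finiteDimensional_range_of_forall_ge N fun x n hn => ?_
      rw [sub_apply, lp.coeFn_sub, Pi.sub_apply, hK, hR2,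
        if_neg (not_lt.2 hn), sub_self]
    exact isCompactOperator_sub_adjoint (K - R N)
  · refine not_absolutelyNormAttaining_of_orthonormal
      (u := fun m => ellTwoBasis (2 * m + 1)) (v := fun m => ellTwoBasis (2 * (2 * m + 1)))
      (orthonormal_ellTwoBasis.comp _ fun i j h => by simpa using h)
      (orthonormal_ellTwoBasis.comp _ fun i j h => by simpa using h)
      (fun m n => orthonormal_ellTwoBasis.2 (by omega)) hodd fun n => hzero _ ⟨n, rfl⟩

end EllTwo

theorem mainTheorem9 :
    (∀ (H : Type*) [NormedAddCommGroup H] [InnerProductSpace ℂ H] [CompleteSpace H]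
        (T : H →L[ℂ] H), IsIdempotentElem T →
        AbsolutelyNormAttaining T → AbsolutelyNormAttaining (buckholtz T)) ∧
    (∃ T : EllTwo →L[ℂ] EllTwo,
        (∀ m : ℕ, T (ellTwoBasis (2 * m + 1)) = ellTwoBasis (2 * m + 1)) ∧
        (∀ m : ℕ, Even m →
          T (ellTwoBasis (2 * m)) = (1 / ((m : ℂ) + 1)) • ellTwoBasis (2 * m + 1)) ∧
        (∀ m : ℕ, Odd m → T (ellTwoBasis (2 * m)) = 0) ∧
        IsIdempotentElem T ∧
        AbsolutelyNormAttaining (buckholtz T) ∧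
        ¬ AbsolutelyNormAttaining T) := by
  exact ⟨fun H _ _ _ T hT hAN => hAN.buckholtz hT,
    exists_idempotent_buckholtz_not_absolutelyNormAttaining⟩
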